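/- Let $A$ be an abelian group isomorphic to $\mathbb{Z}^2$, let $\varphi\colon A\to A$ be an injective group homomorphism, and let $$G = A*_\varphi = \langle A, t \mid t a t^{-1} = \varphi(a)\ \text{ for all } a\in A\rangle$$ be the corresponding ascending HNN extension. The group $G$ is called cyclic subgroup separable if every cyclic subgroup of $G$ is closed in the profinite topology on $G$, that is, the topology whose basic open sets are the cosets of the normal subgroups of finite index. Then $G$ is cyclic subgroup separable if and only if both of the following conditions hold: 1. $\varphi$ has no integer eigenvalue $\lambda$ with $|\lambda|>1$; 2. the trace $\operatorname{tr}(\varphi)$ is coprime to $d=|\det(\varphi)|$. Here the eigenvalues, trace and determinant of $\varphi$ are those of the integer $2\times 2$ matrix representing $\varphi$ in a $\mathbb{Z}$-basis of $A$. -/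

import Mathlib

open scoped Pointwise

/-- The profinite topology on a group `G`: a set is open if and only if it is a union of cosets
of normal subgroups of finite index. -/
abbrev profiniteTopology (G : Type*) [Group G] : TopologicalSpace G where
  IsOpen U := ∀ g ∈ U, ∃ N : Subgroup G, N.Normal ∧ N.FiniteIndex ∧ g • (N : Set G) ⊆ U
  isOpen_univ := fun _ _ => ⟨⊤, inferInstance, inferInstance, Set.subset_univ _⟩
  isOpen_inter := by
    rintro U V hU hV g ⟨hgU, hgV⟩
    obtain ⟨N, hN, hN', hNU⟩ := hU g hgU
    obtain ⟨M, hM, hM', hMV⟩ := hV g hgV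
    refine ⟨N ⊓ M, inferInstance, inferInstance, Set.subset_inter ?_ ?_⟩
    · exact (Set.smul_set_mono (fun x hx => hx.1)).trans hNU
    · exact (Set.smul_set_mono (fun x hx => hx.2)).trans hMV
  isOpen_sUnion := by
    rintro S hS g ⟨U, hU, hgU⟩
    obtain ⟨N, hN, hN', hNU⟩ := hS U hU g hgU
    exact ⟨N, hN, hN', hNU.trans (Set.subset_sUnion_of_mem hU)⟩

/-- The cosets of normal subgroups of finite index form a basis of the profinite topology. -/
theorem profiniteTopology_isTopologicalBasis (G : Type*) [Group G] :
    @TopologicalSpace.IsTopologicalBasis G (profiniteTopology G)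
      {U | ∃ (N : Subgroup G) (g : G), N.Normal ∧ N.FiniteIndex ∧ U = g • (N : Set G)} := by
  let _ : TopologicalSpace G := profiniteTopology G
  refine TopologicalSpace.isTopologicalBasis_of_isOpen_of_nhds ?_ ?_
  · rintro _ ⟨N, g, hN, hN', rfl⟩ h hh
    refine ⟨N, hN, hN', ?_⟩
    rintro _ ⟨x, hx, rfl⟩
    obtain ⟨y, hy, rfl⟩ := hh
    exact ⟨y * x, N.mul_mem hy hx, by simp [mul_assoc]⟩
  · intro g U hg hU
    obtain ⟨N, hN, hN', hNU⟩ := hU g hg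
    exact ⟨_, ⟨N, g, hN, hN', rfl⟩, ⟨1, N.one_mem, by simp⟩, hNU⟩

/-- A subset of a group is separable if it is closed in the profinite topology. -/
def IsSeparableSubset {G : Type*} [Group G] (S : Set G) : Prop :=
  @IsClosed G (profiniteTopology G) S

/-- A group is cyclic subgroup separable if each of its cyclic subgroups is separable. -/
def IsCyclicSubgroupSeparable (G : Type*) [Group G] : Prop :=
  ∀ g : G, IsSeparableSubset (Subgroup.zpowers g : Set G)

/-- The ascending HNN extension `A *_φ = ⟨A, t ∣ t a t⁻¹ = φ a, a ∈ A⟩` of an additive group `A`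
along an injective endomorphism `φ` of `A`: the HNN extension of `A` (written multiplicatively)
whose associated subgroups are `A` itself and the image of `φ`, identified through `φ`. -/
abbrev AscendingHNN {A : Type*} [AddGroup A] (φ : A →+ A) (hφ : Function.Injective φ) : Type _ :=
  HNNExtension (Multiplicative A) ⊤ (AddMonoidHom.toMultiplicative φ).range
    (Subgroup.topEquiv.trans (MonoidHom.ofInjective (f := AddMonoidHom.toMultiplicative φ) hφ))

/-! The elements of height zero form an abelian normal subgroup `K`, the increasing union of the
conjugates `t^(-p) A t^p`, and `G = K ⋊ ⟨t⟩`.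

Necessity: two elements of `K` are inseparable from cyclic subgroups not containing them. If `φ v =
μ v` with `|μ| > 1`, then `w = t⁻¹ v t` is conjugate to `v = w^μ`, so both generate the same
subgroup in every finite quotient. If a prime `p` divides trace and determinant, Cayley-Hamilton
gives `φ² A ⊆ pA`; each `a` in `A` is then infinitely `p`-divisible in `K`, has order prime to `p`
in every finite quotient, and lies there in `⟨a^p⟩`.

Sufficiency: `φ` is eventually periodic modulo `n`, so `K^n` and any element of nonzero height
generate a subgroup of finite index (`finiteIndex_zpowers_sup`). Separation thus reduces to
congruences modulo `K^n`, that is, to `EventuallyDvd` (`isCyclicSubgroupSeparable_of_forall`). If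
these fail to separate a vector from the multiples of another, some primitive `m` is eventually
divisible by all powers of a prime `p`. Either `m` is an eigenvector with eigenvalue divisible by
`p`, or `m` and `P m` span a lattice of finite index and `P` is nilpotent modulo `p`
(`exists_eigenvector_or_dvd`). -/

/-! ### Divisibility along orbits of an integer matrix. -/

open Matrix in
/-- Some power of the matrix `P` maps the vector `x` to a multiple of `n`. -/
def EventuallyDvd (P : Matrix (Fin 2) (Fin 2) ℤ) (n : ℤ) (x : Fin 2 → ℤ) : Prop :=
  ∃ (s : ℕ) (c : Fin 2 → ℤ), (P ^ s) *ᵥ x = n • c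

/-- A nonzero `d` is coprime to integers of arbitrarily large absolute value. -/
theorem Int.eq_zero_of_forall_coprime_dvd {d x : ℤ} (hd : d ≠ 0)
    (h : ∀ n : ℤ, n ≠ 0 → IsCoprime n d → n ∣ x) : x = 0 := by
  by_contra hx
  have hdx : 1 ≤ |d * x| := Int.one_le_abs (mul_ne_zero hd hx)
  have hle : |x| ≤ |d * x| := by
    rw [abs_mul]
    nlinarith [abs_nonneg x, Int.one_le_abs hd]
  -- The factor 3 keeps the inequality strict for `d * x = -1`, where the factor 2 would give
  -- equality.
  have hbig : |x| < |d * x * 3 + 1| := by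
    rcases abs_cases (d * x) with h1 | h1 <;> rcases abs_cases (d * x * 3 + 1) with h2 | h2 <;>
      omega
  have hn : d * x * 3 + 1 ≠ 0 := by omega
  have := h (d * x * 3 + 1) hn ⟨1, -(x * 3), by ring⟩
  exact hx (Int.eq_zero_of_abs_lt_dvd ((abs_dvd _ _).2 this) (by simpa using hbig))

namespace EventuallyDvd

open Matrix

variable {P : Matrix (Fin 2) (Fin 2) ℤ} {n : ℤ} {x y : Fin 2 → ℤ}

theorem add (hx : EventuallyDvd P n x) (hy : EventuallyDvd P n y) :
    EventuallyDvd P n (x + y) := by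
  obtain ⟨s, c, hc⟩ := hx
  obtain ⟨r, e, he⟩ := hy
  refine ⟨s + r, P ^ r *ᵥ c + P ^ s *ᵥ e, ?_⟩
  rw [mulVec_add, smul_add, ← mulVec_smul, ← mulVec_smul, ← hc, ← he, mulVec_mulVec, mulVec_mulVec,
    ← pow_add, ← pow_add, add_comm r s]

theorem smul (k : ℤ) (hx : EventuallyDvd P n x) : EventuallyDvd P n (k • x) := by
  obtain ⟨s, c, hc⟩ := hx
  exact ⟨s, k • c, by rw [mulVec_smul, hc, smul_comm]⟩

theorem mulVec (hx : EventuallyDvd P n x) : EventuallyDvd P n (P *ᵥ x) := by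
  obtain ⟨s, c, hc⟩ := hx
  exact ⟨s, P *ᵥ c, by
    rw [mulVec_mulVec, ← pow_succ, pow_succ', ← mulVec_mulVec, hc, mulVec_smul]⟩

/-- The adjugate of `P ^ s` turns the hypothesis into `n ∣ det ^ s * x i`, and the determinant
cancels. -/
theorem dvd_apply (hn : IsCoprime n P.det) (hx : EventuallyDvd P n x) (i : Fin 2) : n ∣ x i := by
  obtain ⟨s, c, hc⟩ := hx
  have h : P.det ^ s • x = n • ((P ^ s).adjugate *ᵥ c) := by
    rw [← mulVec_smul, ← hc, mulVec_mulVec, adjugate_mul, smul_mulVec, one_mulVec, det_pow]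
  have h' := congrFun h i
  simp only [Pi.smul_apply, smul_eq_mul] at h'
  exact (hn.pow_right (n := s)).dvd_of_dvd_mul_left ⟨_, h'⟩

theorem eq_zero (hP : P.det ≠ 0) (hx : ∀ n : ℤ, n ≠ 0 → EventuallyDvd P n x) : x = 0 := by
  ext i
  exact Int.eq_zero_of_forall_coprime_dvd hP fun n hn hc => dvd_apply hc (hx n hn) i

theorem of_mul {k : ℤ} (hk : k ≠ 0) (h : EventuallyDvd P (k * n) (k • x)) :
    EventuallyDvd P n x := by
  obtain ⟨s, c, hc⟩ := h
  refine ⟨s, c, ?_⟩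
  rw [mulVec_smul, mul_smul] at hc
  exact smul_right_injective _ hk hc

theorem of_isCoprime {k : ℤ} (hk : IsCoprime n k) (h : EventuallyDvd P n (k • x)) :
    EventuallyDvd P n x := by
  obtain ⟨s, c, hc⟩ := h
  obtain ⟨u, v, huv⟩ := hk
  refine ⟨s, u • (P ^ s *ᵥ x) + v • c, ?_⟩
  rw [mulVec_smul] at hc
  rw [smul_add, smul_comm n v, ← hc, smul_smul, smul_smul, ← add_smul, mul_comm n, huv, one_smul]

/-- A nonzero factor costs nothing when all powers are available: its `p`-part is absorbed by a
larger exponent, and the rest is invertible modulo `p ^ j`. -/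
theorem exists_prime_pow {p : ℤ} (hp : Prime p) {k : ℤ} (hk : k ≠ 0)
    (h : ∀ j : ℕ, EventuallyDvd P (p ^ j) (k • x)) (j : ℕ) : EventuallyDvd P (p ^ j) x := by
  obtain ⟨f, u, hu, rfl⟩ := WfDvdMonoid.max_power_factor hk hp.irreducible
  have h1 := h (f + j)
  rw [pow_add, mul_smul] at h1
  exact ((of_mul (pow_ne_zero _ hp.ne_zero) h1)).of_isCoprime
    (((hp.irreducible.coprime_iff_not_dvd).2 hu).pow_left)

/-- If every vector is eventually divisible by the prime `p`, then `P` is nilpotent modulo `p`. -/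
theorem dvd_trace_and_det {p : ℤ} (hp : Prime p) (h : ∀ x, EventuallyDvd P p x) :
    p ∣ P.trace ∧ p ∣ P.det := by
  choose s c hc using h
  obtain ⟨N, hN⟩ : ∃ N, ∀ x : Fin 2 → ℤ, ∀ i, p ∣ (P ^ N *ᵥ x) i := by
    refine ⟨s (Pi.single 0 1) + s (Pi.single 1 1), fun x i => ?_⟩
    have hx : x = x 0 • Pi.single 0 1 + x 1 • Pi.single 1 1 := by
      ext j; fin_cases j <;> simp
    have hd : P ^ (s (Pi.single 0 1) + s (Pi.single 1 1)) *ᵥ x =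
        p • (x 0 • P ^ (s (Pi.single 1 1)) *ᵥ c (Pi.single 0 1) +
          x 1 • P ^ (s (Pi.single 0 1)) *ᵥ c (Pi.single 1 1)) := by
      conv_lhs => rw [hx]
      have key : ∀ y z, p • P ^ s z *ᵥ c y = P ^ (s y + s z) *ᵥ y := fun y z => by
        rw [← mulVec_smul, ← hc, mulVec_mulVec, ← pow_add, add_comm]
      rw [mulVec_add, mulVec_smul, mulVec_smul, smul_add, smul_comm p, smul_comm p, key, key,
        add_comm (s (Pi.single 1 1))]
    rw [hd]
    exact Dvd.intro _ rfl
  have hprime : (Ideal.span {p}).IsPrime := (Ideal.span_singleton_prime hp.ne_zero).2 hp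
  let q := Ideal.Quotient.mk (Ideal.span {p})
  have hq : ∀ z, q z = 0 ↔ p ∣ z := fun z => Ideal.Quotient.eq_zero_iff_dvd p z
  have hnil : (q.mapMatrix P) ^ N = 0 := by
    rw [← map_pow]
    ext i j
    have := hN (Pi.single j 1) i
    rw [mulVec_single_one] at this
    exact (hq _).2 this
  constructor
  · rw [← hq]
    have := (isNilpotent_trace_of_isNilpotent ⟨N, hnil⟩).eq_zero
    simpa [Matrix.trace, q] using this
  · rw [← hq, RingHom.map_det]
    have h2 := congrArg Matrix.det hnil
    rw [det_pow, det_zero] at h2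
    exact eq_zero_of_pow_eq_zero h2

/-- A primitive vector that is eventually divisible by all powers of a prime forces an
eigenvector with an integer eigenvalue divisible by the prime, or nilpotency modulo the prime. -/
theorem exists_eigenvector_or_dvd (hP : P.det ≠ 0) {p : ℤ} (hp : Prime p)
    (hx : IsCoprime (x 0) (x 1)) (h : ∀ j : ℕ, EventuallyDvd P (p ^ j) x) :
    (∃ (μ : ℤ) (v : Fin 2 → ℤ), 1 < |μ| ∧ v ≠ 0 ∧ P *ᵥ v = μ • v) ∨
      p ∣ P.trace ∧ p ∣ P.det := by
  obtain ⟨u, v, huv⟩ := hx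
  set w := P *ᵥ x with hw
  -- This is the determinant of `x` and `P x`. If it vanishes, primitivity of `x` makes `P x` an
  -- integer multiple of `x`.
  by_cases hΔ : x 0 * w 1 - x 1 * w 0 = 0
  · left
    have hx0 : x ≠ 0 := by rintro rfl; simp at huv
    have hμ : w = (u * w 0 + v * w 1) • x := by
      ext i
      fin_cases i
      · simp only [Fin.zero_eta, Pi.smul_apply, smul_eq_mul]
        linear_combination (-w 0) * huv - v * hΔ
      · simp only [Fin.mk_one, Pi.smul_apply, smul_eq_mul]
        linear_combination (-w 1) * huv + u * hΔ
    generalize u * w 0 + v * w 1 = μ at hμ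
    refine ⟨μ, x, ?_, hx0, hμ⟩
    have hμ0 : μ ≠ 0 := by
      rintro rfl
      rw [zero_smul] at hμ
      exact hx0 (eq_zero_of_mulVec_eq_zero hP hμ)
    have hpow : ∀ s : ℕ, P ^ s *ᵥ x = μ ^ s • x := by
      intro s
      induction s with
      | zero => simp
      | succ s ih => rw [pow_succ, ← mulVec_mulVec, ← hw, hμ, mulVec_smul, ih, smul_smul, pow_succ']
    obtain ⟨s, c, hc⟩ := h 1
    rw [hpow, pow_one] at hc
    have h0 : μ ^ s * x 0 = p * c 0 := congrFun hc 0
    have h1 : μ ^ s * x 1 = p * c 1 := congrFun hc 1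
    have hdvd : p ∣ μ := hp.dvd_of_dvd_pow (n := s)
      ⟨u * c 0 + v * c 1, by linear_combination (-μ ^ s) * huv + u * h0 + v * h1⟩
    have h2 : 1 < |p| := by
      have h3 := Int.isUnit_iff_abs_eq.not.1 hp.not_isUnit
      have h4 := Int.one_le_abs hp.ne_zero
      omega
    exact h2.trans_le (Int.le_of_dvd (abs_pos.2 hμ0) ((abs_dvd_abs _ _).2 hdvd))
  · right
    refine dvd_trace_and_det hp fun y => ?_
    have key : ∀ j : ℕ, EventuallyDvd P (p ^ j) ((x 0 * w 1 - x 1 * w 0) • y) := by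
      intro j
      -- Cramer's rule in the basis `x`, `P x`.
      have e : (x 0 * w 1 - x 1 * w 0) • y =
          (y 0 * w 1 - y 1 * w 0) • x + (x 0 * y 1 - x 1 * y 0) • w := by
        ext i
        fin_cases i
        · simp; ring
        · simp; ring
      rw [e]
      exact ((h j).smul _).add ((h j).mulVec.smul _)
    simpa using exists_prime_pow hp hΔ key 1

end EventuallyDvd

theorem exists_isCoprime_smul_eq {a : Fin 2 → ℤ} (ha : a ≠ 0) :
    ∃ (c : ℤ) (m : Fin 2 → ℤ), c ≠ 0 ∧ IsCoprime (m 0) (m 1) ∧ a = c • m := by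
  have hg : 0 < Int.gcd (a 0) (a 1) := by
    rw [Int.gcd_pos_iff]
    by_contra! h
    exact ha (by ext i; fin_cases i <;> simp [h])
  obtain ⟨m0, m1, h, h0, h1⟩ := Int.exists_gcd_one hg
  refine ⟨Int.gcd (a 0) (a 1), ![m0, m1], by exact_mod_cast hg.ne', ?_, ?_⟩
  · simpa using Int.isCoprime_iff_gcd_eq_one.2 h
  · ext i
    fin_cases i
    · simpa [mul_comm] using h0
    · simpa [mul_comm] using h1

open Matrix in
/-- If `P` has no integer eigenvalue of absolute value greater than one and its trace is coprime
to its determinant, then the multiples of a vector are detected modulo all integers. -/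
theorem exists_eq_smul_of_eventuallyDvd {P : Matrix (Fin 2) (Fin 2) ℤ} (hP : P.det ≠ 0)
    (hev : ¬ ∃ (μ : ℤ) (v : Fin 2 → ℤ), 1 < |μ| ∧ v ≠ 0 ∧ P *ᵥ v = μ • v)
    (htr : IsCoprime P.trace P.det) {a x : Fin 2 → ℤ}
    (h : ∀ n : ℤ, n ≠ 0 → ∃ i : ℤ, EventuallyDvd P n (x - i • a)) : ∃ i : ℤ, x = i • a := by
  by_cases ha : a = 0
  · subst ha
    refine ⟨0, ?_⟩
    rw [zero_smul]
    exact EventuallyDvd.eq_zero hP fun n hn => by simpa using h n hn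
  obtain ⟨c, m, hc, hm, rfl⟩ := exists_isCoprime_smul_eq ha
  have hdet : x 0 * m 1 - x 1 * m 0 = 0 := by
    refine Int.eq_zero_of_forall_coprime_dvd hP fun n hn hcop => ?_
    obtain ⟨i, hi⟩ := h n hn
    obtain ⟨y, hy⟩ := hi.dvd_apply hcop 0
    obtain ⟨z, hz⟩ := hi.dvd_apply hcop 1
    simp only [Pi.sub_apply, Pi.smul_apply, smul_eq_mul] at hy hz
    exact ⟨y * m 1 - z * m 0, by linear_combination m 1 * hy - m 0 * hz⟩
  obtain ⟨b, rfl⟩ : ∃ b : ℤ, x = b • m := by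
    obtain ⟨u, v, huv⟩ := hm
    refine ⟨u * x 0 + v * x 1, ?_⟩
    ext i
    fin_cases i
    · simp only [Fin.zero_eta, Pi.smul_apply, smul_eq_mul]
      linear_combination (-x 0) * huv + v * hdet
    · simp only [Fin.mk_one, Pi.smul_apply, smul_eq_mul]
      linear_combination (-x 1) * huv - u * hdet
  suffices hdvd : c ∣ b by
    obtain ⟨i, rfl⟩ := hdvd
    exact ⟨i, by rw [smul_smul, mul_comm]⟩
  have hg : 0 < Int.gcd b c := Int.gcd_pos_of_ne_zero_right _ hc
  obtain ⟨b', c', hbc, hb', hc'⟩ := Int.exists_gcd_one hg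
  set g : ℤ := (Int.gcd b c : ℤ)
  have hg0 : g ≠ 0 := by
    rintro h0
    exact hc (by rw [hc', h0, mul_zero])
  by_cases hunit : IsUnit c'
  · rw [hc', hb']
    exact mul_dvd_mul_right (hunit.dvd) _
  exfalso
  have hc0 : c' ≠ 0 := by rintro rfl; simp at hc'; exact hc hc'
  obtain ⟨p, hp, hpc⟩ := WfDvdMonoid.exists_irreducible_factor hunit hc0
  have hpp : Prime p := hp.prime
  have hpb : ¬ p ∣ b' := fun hpb =>
    hp.not_isUnit ((Int.isCoprime_iff_gcd_eq_one.2 hbc).isUnit_of_dvd' hpb hpc)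
  have key : ∀ j : ℕ, EventuallyDvd P (p ^ j) m := by
    intro j
    -- The difference is `g (b' - i c') m`. The factor `g` in the modulus cancels, and `b' - i c'`
    -- is prime to `p` because `p` divides `c'` but not `b'`.
    obtain ⟨i, hi⟩ := h (g * p ^ j) (mul_ne_zero hg0 (pow_ne_zero _ hpp.ne_zero))
    have e : b • m - i • c • m = g • (b' - i * c') • m := by
      rw [hb', hc']
      simp only [smul_smul, ← sub_smul]
      congr 1
      ring
    rw [e] at hi
    refine (EventuallyDvd.of_mul hg0 hi).of_isCoprime (IsCoprime.pow_left ?_)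
    rw [hp.coprime_iff_not_dvd]
    intro hd
    exact hpb ((dvd_sub_left (hpc.mul_left i)).1 hd)
  rcases EventuallyDvd.exists_eigenvector_or_dvd hP hpp hm key with h1 | ⟨h1, h2⟩
  · exact hev h1
  · exact hp.not_isUnit (htr.isUnit_of_dvd' h1 h2)

/-! ### Structure of the HNN extension and its subgroups of finite index. -/

namespace AscendingHNN

variable {A : Type*} [AddCommGroup A] (φ : A →+ A) (hφ : Function.Injective φ)

/-- The stable letter. -/
noncomputable def stable : AscendingHNN φ hφ := HNNExtension.t

/-- The inclusion of the base group. -/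
noncomputable def base (a : A) : AscendingHNN φ hφ := HNNExtension.of (Multiplicative.ofAdd a)

theorem base_injective : Function.Injective (base φ hφ) := fun _ _ h =>
  Multiplicative.ofAdd.injective (HNNExtension.of_injective _ h)

theorem base_add (a b : A) : base φ hφ (a + b) = base φ hφ a * base φ hφ b :=
  map_mul (HNNExtension.of (φ := Subgroup.topEquiv.trans
    (MonoidHom.ofInjective (f := AddMonoidHom.toMultiplicative φ) hφ)))
    (Multiplicative.ofAdd a) (Multiplicative.ofAdd b)

theorem stable_mul_base (a : A) :
    stable φ hφ * base φ hφ a = base φ hφ (φ a) * stable φ hφ :=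
  HNNExtension.t_mul_of (φ := Subgroup.topEquiv.trans
    (MonoidHom.ofInjective (f := AddMonoidHom.toMultiplicative φ) hφ))
    ⟨Multiplicative.ofAdd a, trivial⟩

/-- The exponent sum of the stable letter. -/
noncomputable def height : AscendingHNN φ hφ →* Multiplicative ℤ :=
  HNNExtension.lift 1 (Multiplicative.ofAdd 1) (by simp)

theorem height_stable : height φ hφ (stable φ hφ) = Multiplicative.ofAdd 1 :=
  HNNExtension.lift_t _ _ _

theorem height_base (a : A) : height φ hφ (base φ hφ a) = 1 :=
  HNNExtension.lift_of _ _ _ _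

/-- The inclusion of the base group followed by conjugation with `stable ^ (-p)`. -/
noncomputable def conjBase (p : ℕ) : Multiplicative A →* AscendingHNN φ hφ :=
  MonoidHom.mk' (fun a => (stable φ hφ ^ p)⁻¹ * base φ hφ a.toAdd * stable φ hφ ^ p)
    (fun a b => by rw [toAdd_mul, base_add]; group)

variable {φ hφ}

open Multiplicative

theorem conjBase_apply (p : ℕ) (a : A) : conjBase φ hφ p (ofAdd a) =
    (stable φ hφ ^ p)⁻¹ * base φ hφ a * stable φ hφ ^ p := rfl

theorem conjBase_zero (a : A) : conjBase φ hφ 0 (ofAdd a) = base φ hφ a := by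
  simp [conjBase_apply]

theorem conjBase_succ_map (p : ℕ) (a : A) :
    conjBase φ hφ (p + 1) (ofAdd (φ a)) = conjBase φ hφ p (ofAdd a) := by
  rw [conjBase_apply, conjBase_apply, pow_succ', mul_inv_rev, mul_assoc, mul_assoc,
    ← mul_assoc (base φ hφ (φ a)), ← stable_mul_base]
  group

/-- This brings elements of levels `p` and `q` to the common level `p + q`, where they can be
compared inside `A`. -/
theorem conjBase_add_iterate (p q : ℕ) (a : A) :
    conjBase φ hφ (p + q) (ofAdd (φ^[q] a)) = conjBase φ hφ p (ofAdd a) := by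
  induction q with
  | zero => rfl
  | succ q ih => rw [Function.iterate_succ_apply', ← add_assoc, conjBase_succ_map, ih]

theorem conjBase_injective (p : ℕ) : Function.Injective (conjBase φ hφ p) := by
  intro a b h
  have h' : (stable φ hφ ^ p)⁻¹ * base φ hφ a.toAdd * stable φ hφ ^ p =
    (stable φ hφ ^ p)⁻¹ * base φ hφ b.toAdd * stable φ hφ ^ p := h
  exact toAdd.injective (base_injective φ hφ (mul_left_cancel (mul_right_cancel h')))

theorem height_conjBase (p : ℕ) (a : Multiplicative A) : height φ hφ (conjBase φ hφ p a) = 1 := by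
  change height φ hφ ((stable φ hφ ^ p)⁻¹ * base φ hφ a.toAdd * stable φ hφ ^ p) = 1
  simp [height_base]

theorem conjBase_commute (p q : ℕ) (a b : A) :
    Commute (conjBase φ hφ p (ofAdd a)) (conjBase φ hφ q (ofAdd b)) := by
  rw [← conjBase_add_iterate p q a, ← conjBase_add_iterate q p b, add_comm q p]
  exact (Commute.all _ _).map _

theorem stable_conj_conjBase (p : ℕ) (a : A) :
    stable φ hφ * conjBase φ hφ p (ofAdd a) * (stable φ hφ)⁻¹ = conjBase φ hφ p (ofAdd (φ a)) := by
  rw [conjBase_apply, conjBase_apply, mul_assoc (stable φ hφ ^ p)⁻¹, mul_assoc (stable φ hφ ^ p)⁻¹]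
  have h := stable_mul_base φ hφ a
  rw [← mul_inv_eq_iff_eq_mul] at h
  rw [← h]
  group

theorem stable_inv_conj_conjBase (p : ℕ) (a : A) :
    (stable φ hφ)⁻¹ * conjBase φ hφ p (ofAdd a) * stable φ hφ =
      conjBase φ hφ (p + 1) (ofAdd a) := by
  rw [conjBase_apply, conjBase_apply, pow_succ]
  group

variable (φ hφ) in
/-- The normal subgroup of `n`-th powers of elements of height zero. -/
def powSubgroup (n : ℤ) : Subgroup (AscendingHNN φ hφ) where
  carrier := {g | ∃ (p : ℕ) (a : A), g = conjBase φ hφ p (ofAdd (n • a))}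
  one_mem' := ⟨0, 0, by simp⟩
  mul_mem' := by
    rintro _ _ ⟨p, a, rfl⟩ ⟨q, b, rfl⟩
    refine ⟨p + q, φ^[q] a + φ^[p] b, ?_⟩
    rw [← conjBase_add_iterate p q, ← conjBase_add_iterate q p, add_comm q p, ← map_mul,
      ← ofAdd_add, smul_add]
    rw [iterate_map_zsmul, iterate_map_zsmul]
  inv_mem' := by
    rintro _ ⟨p, a, rfl⟩
    exact ⟨p, -a, by rw [smul_neg, ofAdd_neg, map_inv]⟩

theorem mem_powSubgroup {n : ℤ} {g : AscendingHNN φ hφ} : g ∈ powSubgroup φ hφ n ↔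
    ∃ (p : ℕ) (a : A), g = conjBase φ hφ p (ofAdd (n • a)) := Iff.rfl

theorem conjBase_mem_powSubgroup {n : ℤ} {p : ℕ} {a : A} :
    conjBase φ hφ p (ofAdd a) ∈ powSubgroup φ hφ n ↔ ∃ (s : ℕ) (c : A), φ^[s] a = n • c := by
  constructor
  · rintro ⟨q, b, h⟩
    rw [← conjBase_add_iterate p q, ← conjBase_add_iterate q p, add_comm q p] at h
    exact ⟨q, φ^[p] b, by
      rw [← iterate_map_zsmul]; exact ofAdd.injective (conjBase_injective _ h)⟩
  · rintro ⟨s, c, h⟩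
    exact ⟨p + s, c, by rw [← h, conjBase_add_iterate]⟩

theorem mem_powSubgroup_one {g : AscendingHNN φ hφ} : g ∈ powSubgroup φ hφ 1 ↔
    ∃ (p : ℕ) (a : A), g = conjBase φ hφ p (ofAdd a) := by
  simp [mem_powSubgroup]

theorem eq_top_of_base_of_stable {H : Subgroup (AscendingHNN φ hφ)}
    (hb : ∀ a, base φ hφ a ∈ H) (hs : stable φ hφ ∈ H) : H = ⊤ := by
  refine eq_top_iff.2 fun g _ => ?_
  induction g using HNNExtension.induction_on with
  | of a => exact hb a.toAdd
  | t => exact hs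
  | mul x y hx hy => exact H.mul_mem (hx trivial) (hy trivial)
  | inv x hx => exact H.inv_mem (hx trivial)

instance powSubgroup_normal (n : ℤ) : (powSubgroup φ hφ n).Normal := by
  rw [← Subgroup.normalizer_eq_top_iff]
  -- The base group centralizes all elements of height zero; `t` acts on them through `φ`, and `t⁻¹`
  -- raises the level.
  refine eq_top_of_base_of_stable (fun a => ?_) ?_
  · rw [Subgroup.mem_normalizer_iff]
    have key : ∀ (a : A) h, h ∈ powSubgroup φ hφ n → base φ hφ a * h * (base φ hφ a)⁻¹ = h := by
      rintro a _ ⟨p, b, rfl⟩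
      rw [← conjBase_zero, (conjBase_commute _ _ _ _).eq, mul_inv_cancel_right]
    refine fun h => ⟨fun hh => by rwa [key a h hh], fun hh => ?_⟩
    obtain ⟨p, b, hb⟩ := hh
    have h2 : h = (base φ hφ a)⁻¹ * (conjBase φ hφ p (ofAdd (n • b)) * base φ hφ a) := by
      rw [← hb]; group
    rw [← conjBase_zero, (conjBase_commute _ _ _ _).eq, inv_mul_cancel_left] at h2
    rw [h2]
    exact ⟨p, b, rfl⟩
  · rw [Subgroup.mem_normalizer_iff]
    refine fun h => ⟨?_, ?_⟩
    · rintro ⟨p, b, rfl⟩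
      rw [stable_conj_conjBase, conjBase_mem_powSubgroup]
      exact ⟨0, φ b, by simp⟩
    · rintro ⟨p, b, hb⟩
      have := stable_inv_conj_conjBase (hφ := hφ) p (n • b)
      rw [← hb] at this
      exact ⟨p + 1, b, by rw [← this]; group⟩

theorem powSubgroup_one_sup_zpowers :
    powSubgroup φ hφ 1 ⊔ Subgroup.zpowers (stable φ hφ) = ⊤ :=
  eq_top_of_base_of_stable
    (fun a => Subgroup.mem_sup_left (mem_powSubgroup_one.2 ⟨0, a, (conjBase_zero a).symm⟩))
    (Subgroup.mem_sup_right (Subgroup.mem_zpowers _))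

theorem powSubgroup_le_height_ker (n : ℤ) : powSubgroup φ hφ n ≤ (height φ hφ).ker := by
  rintro _ ⟨p, a, rfl⟩
  exact height_conjBase _ _

theorem height_stable_zpow (l : ℤ) : height φ hφ (stable φ hφ ^ l) = ofAdd l := by
  rw [map_zpow, height_stable, ← ofAdd_zsmul, smul_eq_mul, mul_one]

theorem powSubgroup_one_eq_ker : powSubgroup φ hφ 1 = (height φ hφ).ker := by
  refine le_antisymm (powSubgroup_le_height_ker 1) fun g hg => ?_
  have : g ∈ powSubgroup φ hφ 1 ⊔ Subgroup.zpowers (stable φ hφ) := by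
    rw [powSubgroup_one_sup_zpowers]; trivial
  obtain ⟨y, hy, _, ⟨l, rfl⟩, rfl⟩ := Subgroup.mem_sup_of_normal_left.1 this
  rw [MonoidHom.mem_ker, map_mul, powSubgroup_le_height_ker 1 hy, one_mul] at hg
  simp only [height_stable_zpow] at hg
  have hl : l = 0 := ofAdd.injective hg
  simpa [hl] using hy

theorem height_eq_one_iff {g : AscendingHNN φ hφ} : height φ hφ g = 1 ↔
    ∃ (p : ℕ) (a : A), g = conjBase φ hφ p (ofAdd a) := by
  rw [← mem_powSubgroup_one, powSubgroup_one_eq_ker, MonoidHom.mem_ker]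

/-- A subgroup generated by an element of nonzero height and the `n`-th powers contains no
further elements of height zero. -/
theorem mem_powSubgroup_of_mem_sup {n : ℤ} {g x : AscendingHNN φ hφ} (hg : height φ hφ g ≠ 1)
    (hx : height φ hφ x = 1) (h : x ∈ Subgroup.zpowers g ⊔ powSubgroup φ hφ n) :
    x ∈ powSubgroup φ hφ n := by
  obtain ⟨_, ⟨i, rfl⟩, d, hd, rfl⟩ := Subgroup.mem_sup_of_normal_right.1 h
  rw [map_mul, powSubgroup_le_height_ker n hd, mul_one] at hx
  simp only [map_zpow] at hx
  have hi : i • (height φ hφ g).toAdd = 0 := congrArg toAdd hx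
  rw [smul_eq_mul, mul_eq_zero] at hi
  rcases hi with rfl | hi
  · simpa using hd
  · exact absurd (toAdd.injective hi) hg

/-- If two different iterates of `φ` agree modulo `n`, then every element of height zero is
congruent to an element of the base group. -/
theorem exists_base_inv_mul_mem {n : ℤ} {k r : ℕ} (hr : 0 < r)
    (h : ∀ a : A, ∃ c, φ^[k + r] a - φ^[k] a = n • c) (p : ℕ) (a : A) :
    ∃ b, (base φ hφ b)⁻¹ * conjBase φ hφ p (ofAdd a) ∈ powSubgroup φ hφ n := by
  have key : ∀ m : ℕ, ∃ c, φ^[k + m * r] a - φ^[k] a = n • c := by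
    intro m
    induction m with
    | zero => exact ⟨0, by simp⟩
    | succ m ih =>
      obtain ⟨c, hc⟩ := ih
      obtain ⟨e, he⟩ := h (φ^[m * r] a)
      rw [← Function.iterate_add_apply, ← Function.iterate_add_apply] at he
      refine ⟨e + c, ?_⟩
      rw [smul_add, ← he, ← hc, show k + (m + 1) * r = k + r + m * r by ring]
      abel
  obtain ⟨c, hc⟩ := key p
  -- On the eventual image modulo `n`, `φ ^ (p * r)` is the identity, so this iterate inverts `φ ^
  -- p`.
  refine ⟨φ^[p * r - p] a, ?_⟩
  rw [← conjBase_zero, ← conjBase_add_iterate 0 p, zero_add, ← map_inv, ← map_mul, ← ofAdd_neg,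
    ← ofAdd_add, conjBase_mem_powSubgroup]
  refine ⟨k, -c, ?_⟩
  rw [← Function.iterate_add_apply, iterate_map_add, iterate_map_neg, ← Function.iterate_add_apply,
    smul_neg, ← hc, show k + (p + (p * r - p)) = k + p * r by
      have := Nat.le_mul_of_pos_right p hr; omega]
  abel

theorem base_inv_mul_mem_powSubgroup {n : ℤ} {a b c : A} (h : b - a = n • c) :
    (base φ hφ a)⁻¹ * base φ hφ b ∈ powSubgroup φ hφ n := by
  rw [← conjBase_zero, ← conjBase_zero, ← map_inv, ← map_mul, ← ofAdd_neg,
    ← ofAdd_add, conjBase_mem_powSubgroup]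
  exact ⟨0, c, by rw [← h]; simp [neg_add_eq_sub]⟩

/-- A subgroup generated by an element of nonzero height and the `n`-th powers has finite index,
provided that the base group is finite modulo `n`. -/
theorem finiteIndex_zpowers_sup {n : ℤ} {k r : ℕ} (hr : 0 < r)
    (h : ∀ a : A, ∃ c, φ^[k + r] a - φ^[k] a = n • c)
    {F : Set A} (hF : F.Finite) (hFA : ∀ a, ∃ f ∈ F, ∃ c, a - f = n • c)
    {g : AscendingHNN φ hφ} (hg : height φ hφ g ≠ 1) :
    (Subgroup.zpowers g ⊔ powSubgroup φ hφ n).FiniteIndex := by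
  set C := Subgroup.zpowers g ⊔ powSubgroup φ hφ n
  set m : ℤ := (height φ hφ g).toAdd with hm
  have hm0 : m ≠ 0 := fun h0 => hg (toAdd.injective h0)
  suffices Finite (AscendingHNN φ hφ ⧸ C) from Subgroup.finiteIndex_of_finite_quotient
  rw [← Set.finite_univ_iff]
  refine ((hF.prod (Set.finite_Ico (0 : ℤ) |m|)).image
    fun z => ((base φ hφ z.1 * stable φ hφ ^ z.2 : AscendingHNN φ hφ) :
      AscendingHNN φ hφ ⧸ C)).subset ?_
  rintro q -
  obtain ⟨x, rfl⟩ := QuotientGroup.mk_surjective q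
  set l : ℤ := (height φ hφ x).toAdd with hl
  have hy : height φ hφ (x * g ^ (-(l / m)) * stable φ hφ ^ (-(l % m))) = 1 := by
    rw [map_mul, map_mul, map_zpow, height_stable_zpow]
    apply toAdd.injective
    rw [toAdd_mul, toAdd_mul, toAdd_zpow, ← hl, ← hm, toAdd_ofAdd, toAdd_one, smul_eq_mul]
    linarith [Int.emod_add_ediv_mul l m]
  obtain ⟨p, a, hpa⟩ := height_eq_one_iff.1 hy
  obtain ⟨b, hb⟩ := exists_base_inv_mul_mem (hφ := hφ) hr h p a
  obtain ⟨f, hf, c, hc⟩ := hFA b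
  have hd := (powSubgroup φ hφ n).mul_mem (base_inv_mul_mem_powSubgroup (hφ := hφ) hc) hb
  rw [← hpa] at hd
  refine ⟨(f, l % m), ⟨hf, Int.emod_nonneg _ hm0, Int.emod_lt_abs _ hm0⟩, ?_⟩
  rw [QuotientGroup.eq]
  have hd' := (powSubgroup_normal (hφ := hφ) n).conj_mem _ hd (stable φ hφ ^ (-(l % m)))
  have := C.mul_mem (Subgroup.mem_sup_right hd' : _ ∈ C)
    (Subgroup.mem_sup_left (Subgroup.zpow_mem_zpowers g (l / m)) : _ ∈ C)
  convert this using 1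
  simp only [zpow_neg]
  group

end AscendingHNN

/-! ### Separability and cyclic subgroups of finite groups. -/

theorem isSeparableSubset_iff {G : Type*} [Group G] {S : Set G} : IsSeparableSubset S ↔
    ∀ x ∉ S, ∃ N : Subgroup G, N.Normal ∧ N.FiniteIndex ∧ ∀ y ∈ N, x * y ∉ S := by
  unfold IsSeparableSubset
  rw [← @isOpen_compl_iff G S (profiniteTopology G)]
  refine forall₂_congr fun x _ => exists_congr fun N => and_congr_right fun _ =>
    and_congr_right fun _ => ?_
  rw [Set.smul_set_subset_iff]
  exact Iff.rfl

/-- In a separable subset there are no points outside that are finitely approximable. -/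
theorem IsSeparableSubset.mem_of_forall {G : Type*} [Group G] {S : Set G}
    (hS : IsSeparableSubset S) {x : G}
    (h : ∀ N : Subgroup G, N.Normal → N.FiniteIndex → ∃ y ∈ N, x * y ∈ S) : x ∈ S := by
  by_contra hx
  obtain ⟨N, h1, h2, h3⟩ := isSeparableSubset_iff.1 hS x hx
  obtain ⟨y, hy, hxy⟩ := h N h1 h2
  exact h3 y hy hxy

theorem IsSeparableSubset.mem_zpowers_of_forall {G : Type*} [Group G] {g x : G}
    (hS : IsSeparableSubset (Subgroup.zpowers g : Set G))
    (h : ∀ N : Subgroup G, ∀ _ : N.Normal, N.FiniteIndex →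
      (x : G ⧸ N) ∈ Subgroup.zpowers (g : G ⧸ N)) : x ∈ Subgroup.zpowers g := by
  refine hS.mem_of_forall fun N h1 h2 => ?_
  obtain ⟨i, hi⟩ := h N h1 h2
  have hi' : ((g ^ i : G) : G ⧸ N) = x := by rw [← hi]; rfl
  exact ⟨x⁻¹ * g ^ i, QuotientGroup.eq.1 hi'.symm, i, by simp⟩

/-- Conjugate elements have equal order, so the inclusion of `⟨y⟩` in `⟨x⟩` is an equality. -/
theorem Subgroup.mem_zpowers_of_zpow_eq_of_isConj {Q : Type*} [Group Q] [Finite Q] {x y c : Q}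
    {m : ℤ} (hxy : x ^ m = y) (hc : c * x * c⁻¹ = y) : x ∈ Subgroup.zpowers y := by
  have hle : Subgroup.zpowers y ≤ Subgroup.zpowers x := by
    rw [Subgroup.zpowers_le, ← hxy]
    exact Subgroup.zpow_mem_zpowers x m
  have hcard : Nat.card (Subgroup.zpowers x) = Nat.card (Subgroup.zpowers y) := by
    rw [Nat.card_zpowers, Nat.card_zpowers, ← hc]
    exact (orderOf_injective (MulAut.conj c).toMonoidHom (MulAut.conj c).injective x).symm
  rw [Subgroup.eq_of_le_of_card_ge hle hcard.le]
  exact Subgroup.mem_zpowers x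

/-- With `p ^ f` the `p`-part of the group order, `x` is a `p ^ f`-th power and so has order prime
to `p`. -/
theorem Subgroup.mem_zpowers_pow_of_forall_exists_pow {Q : Type*} [Group Q] [Finite Q] {x : Q}
    {p : ℕ} (hp : p.Prime) (h : ∀ f : ℕ, ∃ y : Q, y ^ p ^ f = x) :
    x ∈ Subgroup.zpowers (x ^ p) := by
  obtain ⟨f, u, hu, hfu⟩ := Nat.exists_eq_pow_mul_and_not_dvd (Nat.card_pos (α := Q)).ne' p
    hp.ne_one
  obtain ⟨y, hy⟩ := h f
  have hxu : x ^ u = 1 := by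
    rw [← hy, ← pow_mul, ← hfu, pow_card_eq_one']
  have hcop : (p.gcd u) = 1 := (Nat.Prime.coprime_iff_not_dvd hp).2 hu
  have hb := Nat.gcd_eq_gcd_ab p u
  rw [hcop] at hb
  refine ⟨Nat.gcdA p u, ?_⟩
  calc (x ^ p) ^ (Nat.gcdA p u) = (x ^ p) ^ (Nat.gcdA p u) * (x ^ u) ^ (Nat.gcdB p u) := by
        rw [hxu, one_zpow, mul_one]
    _ = x ^ ((p : ℤ) * Nat.gcdA p u + u * Nat.gcdB p u) := by
        rw [zpow_add, zpow_mul, zpow_mul, zpow_natCast, zpow_natCast]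
    _ = x := by rw [← hb]; simp

/-! ### Two obstructions and a criterion for separability. -/

namespace AscendingHNN

open Multiplicative

variable {A : Type*} [AddCommGroup A] {φ : A →+ A} {hφ : Function.Injective φ}

theorem base_zsmul (i : ℤ) (a : A) : base φ hφ (i • a) = base φ hφ a ^ i := by
  rw [← conjBase_zero, ← conjBase_zero, ofAdd_zsmul, map_zpow]

theorem not_isCyclicSubgroupSeparable_of_eigenvector [IsAddTorsionFree A] {μ : ℤ} {v : A}
    (hμ : 1 < |μ|) (hv : v ≠ 0) (h : φ v = μ • v) :
    ¬ IsCyclicSubgroupSeparable (AscendingHNN φ hφ) := by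
  intro hsep
  have h1 : conjBase φ hφ 1 (ofAdd v) ^ μ = base φ hφ v := by
    rw [← map_zpow, ← ofAdd_zsmul, ← h, ← conjBase_zero]
    exact conjBase_succ_map 0 v
  have h2 : stable φ hφ * conjBase φ hφ 1 (ofAdd v) * (stable φ hφ)⁻¹ = base φ hφ v := by
    rw [conjBase_apply]; group
  have hmem : conjBase φ hφ 1 (ofAdd v) ∈ Subgroup.zpowers (base φ hφ v) := by
    refine (hsep _).mem_zpowers_of_forall fun N _ _ => ?_
    refine Subgroup.mem_zpowers_of_zpow_eq_of_isConj (m := μ) (c := (stable φ hφ : _ ⧸ N)) ?_ ?_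
    · rw [← h1]; rfl
    · rw [← h2]; rfl
  obtain ⟨i, hi⟩ := hmem
  simp only [← base_zsmul] at hi
  rw [← conjBase_zero, ← conjBase_add_iterate 0 1, zero_add] at hi
  have h3 : φ (i • v) = v := ofAdd.injective (conjBase_injective 1 hi)
  rw [map_zsmul, h, smul_smul] at h3
  have h4 : (i * μ) • v = (1 : ℤ) • v := by rw [h3, one_smul]
  have h5 := smul_left_injective ℤ hv h4
  have := Int.isUnit_iff_abs_eq.1 (IsUnit.of_mul_eq_one i ((mul_comm _ _).trans h5))
  omega

theorem not_isCyclicSubgroupSeparable_of_sq_dvd [IsAddTorsionFree A] [Nontrivial A] {p : ℕ}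
    (hp : p.Prime) (h : ∀ a, ∃ c, φ (φ a) = p • c) :
    ¬ IsCyclicSubgroupSeparable (AscendingHNN φ hφ) := by
  intro hsep
  obtain ⟨a, ha⟩ := exists_ne (0 : A)
  have key : ∀ (f : ℕ) (a : A), ∃ c, φ^[2 * f] a = p ^ f • c := by
    intro f
    induction f with
    | zero => exact fun a => ⟨a, by simp⟩
    | succ f ih =>
      intro a
      obtain ⟨b, hb⟩ := h a
      obtain ⟨c, hc⟩ := ih b
      refine ⟨c, ?_⟩
      rw [show 2 * (f + 1) = 2 * f + 2 by ring, Function.iterate_add_apply]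
      change φ^[2 * f] (φ (φ a)) = _
      rw [hb, iterate_map_nsmul, hc, smul_smul, pow_succ']
  have hmem : base φ hφ a ∈ Subgroup.zpowers (base φ hφ a ^ p) := by
    refine (hsep _).mem_zpowers_of_forall fun N _ _ => ?_
    refine Subgroup.mem_zpowers_pow_of_forall_exists_pow (x := (base φ hφ a : _ ⧸ N)) hp
      fun f => ?_
    obtain ⟨c, hc⟩ := key f a
    refine ⟨(conjBase φ hφ (2 * f) (ofAdd c) : _), ?_⟩
    rw [← QuotientGroup.mk_pow, ← map_pow, ← ofAdd_nsmul, ← hc, ← conjBase_zero]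
    congr 1
    simpa using conjBase_add_iterate (hφ := hφ) 0 (2 * f) a
  obtain ⟨i, hi⟩ := hmem
  simp only [← zpow_natCast, ← base_zsmul, smul_smul] at hi
  have h4 : (i * p) • a = (1 : ℤ) • a := by rw [base_injective _ _ hi, one_smul]
  have h5 := smul_left_injective ℤ ha h4
  have h6 := Int.isUnit_iff_natAbs_eq.1 (IsUnit.of_mul_eq_one i ((mul_comm _ _).trans h5))
  exact hp.ne_one (by simpa using h6)

/-- A criterion for an ascending HNN extension of an abelian group to be cyclic subgroup
separable. -/
theorem isCyclicSubgroupSeparable_of_forall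
    (hfin : ∀ n : ℤ, n ≠ 0 → (∃ k r : ℕ, 0 < r ∧ ∀ a : A, ∃ c, φ^[k + r] a - φ^[k] a = n • c) ∧
      ∃ F : Set A, F.Finite ∧ ∀ a, ∃ f ∈ F, ∃ c, a - f = n • c)
    (hcyc : ∀ a x : A, (∀ n : ℤ, n ≠ 0 → ∃ (i : ℤ) (s : ℕ) (c : A), φ^[s] (x - i • a) = n • c) →
      ∃ i : ℤ, x = i • a) :
    IsCyclicSubgroupSeparable (AscendingHNN φ hφ) := by
  have hindex : ∀ {n : ℤ}, n ≠ 0 → ∀ {g : AscendingHNN φ hφ}, height φ hφ g ≠ 1 →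
      (Subgroup.zpowers g ⊔ powSubgroup φ hφ n).FiniteIndex := by
    intro n hn g hg
    obtain ⟨⟨k, r, hr, h⟩, F, hF, hFA⟩ := hfin n hn
    exact finiteIndex_zpowers_sup hr h hF hFA hg
  intro g
  rw [isSeparableSubset_iff]
  intro x hx
  by_cases hg : height φ hφ g = 1
  · by_cases hxh : height φ hφ x = 1
    · obtain ⟨p, a, rfl⟩ := height_eq_one_iff.1 hg
      obtain ⟨q, b, rfl⟩ := height_eq_one_iff.1 hxh
      rw [← conjBase_add_iterate p q] at hx ⊢
      rw [← conjBase_add_iterate q p, add_comm q p] at hx ⊢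
      have hnot : ¬ ∃ i : ℤ, φ^[p] b = i • φ^[q] a := by
        rintro ⟨i, hi⟩
        exact hx ⟨i, by simp only [hi, ofAdd_zsmul, map_zpow]⟩
      have hn := mt (hcyc (φ^[q] a) (φ^[p] b)) hnot
      push Not at hn
      obtain ⟨n, hn, hni⟩ := hn
      have hstable : height φ hφ (stable φ hφ) ≠ 1 := by
        rw [height_stable]; decide
      have := hindex hn hstable
      refine ⟨(Subgroup.zpowers (stable φ hφ) ⊔ powSubgroup φ hφ n).normalCore,
        inferInstance, inferInstance, ?_⟩
      rintro y hy ⟨i, hi⟩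
      simp only [← map_zpow, ← ofAdd_zsmul] at hi
      rw [← inv_mul_eq_iff_eq_mul, ← map_inv, ← map_mul, ← ofAdd_neg, ← ofAdd_add] at hi
      have hy' := Subgroup.inv_mem _ (Subgroup.normalCore_le _ hy)
      rw [← hi, ← map_inv, ← ofAdd_neg] at hy'
      obtain ⟨s, c, hc⟩ := conjBase_mem_powSubgroup.1
        (mem_powSubgroup_of_mem_sup hstable (height_conjBase _ _) hy')
      refine hni i s c ?_
      rw [← hc]
      congr 1
      abel
    · set l : ℤ := (height φ hφ x).toAdd with hl
      have hl0 : l ≠ 0 := fun h0 => hxh (toAdd.injective h0)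
      -- Heights modulo `2 * l` suffice: `⟨g⟩` has height zero, and `l` is not a multiple of `2 *
      -- l`.
      have hst : height φ hφ (stable φ hφ ^ (2 * l)) ≠ 1 := by
        rw [height_stable_zpow]
        intro h0
        have : 2 * l = 0 := ofAdd.injective h0
        omega
      have := hindex one_ne_zero hst
      refine ⟨(Subgroup.zpowers (stable φ hφ ^ (2 * l)) ⊔ powSubgroup φ hφ 1).normalCore,
        inferInstance, inferInstance, ?_⟩
      rintro y hy ⟨i, hi⟩
      obtain ⟨_, ⟨j, rfl⟩, d, hd, rfl⟩ :=
        Subgroup.mem_sup_of_normal_right.1 (Subgroup.normalCore_le _ hy)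
      have hd1 : height φ hφ d = 1 := powSubgroup_le_height_ker 1 hd
      have h1 := congrArg (fun z => (height φ hφ z).toAdd) hi
      simp only [map_zpow, hg, one_zpow, map_mul, hd1, mul_one,
        toAdd_one, toAdd_mul, ← hl, toAdd_zpow, height_stable, toAdd_ofAdd, smul_eq_mul] at h1
      have h2 : l * (1 + 2 * j) = 0 := by linear_combination -h1
      rcases mul_eq_zero.1 h2 with h2 | h2 <;> omega
  · suffices ∃ n : ℤ, n ≠ 0 ∧ x ∉ Subgroup.zpowers g ⊔ powSubgroup φ hφ n by
      obtain ⟨n, hn, hxn⟩ := this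
      have := hindex hn hg
      refine ⟨(Subgroup.zpowers g ⊔ powSubgroup φ hφ n).normalCore,
        inferInstance, inferInstance, fun y hy hxy => hxn ?_⟩
      have h1 := Subgroup.mul_mem _ (Subgroup.mem_sup_left hxy)
        (Subgroup.inv_mem _ (Subgroup.normalCore_le _ hy))
      rwa [mul_inv_cancel_right] at h1
    by_contra! hall
    obtain ⟨_, ⟨i, rfl⟩, d, hd, rfl⟩ :=
      Subgroup.mem_sup_of_normal_right.1 (hall 1 one_ne_zero)
    obtain ⟨p, a, rfl⟩ := mem_powSubgroup_one.1 hd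
    -- The case `n = 1` fixed `x = g ^ i * d`; now `d` lies in every `powSubgroup`, and `hcyc` for
    -- the zero vector makes it trivial.
    have ha : ∃ i : ℤ, a = i • (0 : A) := by
      refine hcyc 0 a fun n hn => ⟨0, ?_⟩
      rw [smul_zero, sub_zero]
      refine (conjBase_mem_powSubgroup (p := p) (hφ := hφ)).1
        (mem_powSubgroup_of_mem_sup hg (height_conjBase _ _) ?_)
      have h1 := Subgroup.mul_mem _ (Subgroup.mem_sup_left
        (Subgroup.zpow_mem_zpowers g (-i))) (hall n hn)
      rwa [zpow_neg, inv_mul_cancel_left] at h1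
    obtain ⟨j, rfl⟩ := ha
    exact hx ⟨i, by simp⟩

end AscendingHNN

/-! ### Passage to the matrix of `φ`. -/

open Matrix in
theorem mainTheorem4 {A : Type*} [AddCommGroup A] (hA : Nonempty (A ≃+ (Fin 2 → ℤ)))
    (φ : A →+ A) (hφ : Function.Injective φ) :
    IsCyclicSubgroupSeparable (AscendingHNN φ hφ) ↔
      (¬ ∃ μ : ℤ, 1 < |μ| ∧ Module.End.HasEigenvalue φ.toIntLinearMap μ) ∧
        IsCoprime (LinearMap.trace ℤ A φ.toIntLinearMap)
          |LinearMap.det φ.toIntLinearMap| := by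
  obtain ⟨e⟩ := hA
  let b : Module.Basis (Fin 2) ℤ A := Module.Basis.ofEquivFun e.toIntLinearEquiv
  set P := LinearMap.toMatrix b b φ.toIntLinearMap with hPdef
  have hPe : ∀ a, e (φ a) = P *ᵥ e a := fun a =>
    (LinearMap.toMatrix_mulVec_repr b b φ.toIntLinearMap a).symm
  have hPs : ∀ (s : ℕ) a, e (φ^[s] a) = P ^ s *ᵥ e a := by
    intro s
    induction s with
    | zero => simp
    | succ s ih => intro a; rw [Function.iterate_succ_apply, ih, hPe, mulVec_mulVec, pow_succ]
  have hdet0 : P.det ≠ 0 := by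
    intro h0
    obtain ⟨v, hv, hPv⟩ := exists_mulVec_eq_zero_iff.2 h0
    rw [← e.apply_symm_apply v, ← hPe, e.map_eq_zero_iff, map_eq_zero_iff φ hφ,
      e.symm.map_eq_zero_iff] at hPv
    exact hv hPv
  have htf : IsAddTorsionFree A := e.injective.isAddTorsionFree e.toAddMonoidHom
  have hnt : Nontrivial A := e.toEquiv.nontrivial
  have hcop : IsCoprime (LinearMap.trace ℤ A φ.toIntLinearMap) |LinearMap.det φ.toIntLinearMap| ↔
      IsCoprime P.trace P.det := by
    rw [LinearMap.trace_eq_matrix_trace ℤ b, ← LinearMap.det_toMatrix b, IsCoprime.abs_right_iff]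
  rw [hcop]
  constructor
  · intro hsep
    constructor
    · rintro ⟨μ, hμ, hev⟩
      obtain ⟨v, hv⟩ := hev.exists_hasEigenvector
      exact AscendingHNN.not_isCyclicSubgroupSeparable_of_eigenvector hμ hv.2 hv.apply_eq_smul hsep
    · by_contra hn
      rw [Int.isCoprime_iff_gcd_eq_one] at hn
      obtain ⟨p, hp, hpg⟩ := Nat.exists_prime_and_dvd hn
      have hpg' : (p : ℤ) ∣ Int.gcd P.trace P.det := Int.natCast_dvd_natCast.2 hpg
      obtain ⟨t, ht⟩ := hpg'.trans (Int.gcd_dvd_left _ _)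
      obtain ⟨d, hd⟩ := hpg'.trans (Int.gcd_dvd_right _ _)
      refine AscendingHNN.not_isCyclicSubgroupSeparable_of_sq_dvd hp (fun a => ?_) hsep
      -- Cayley-Hamilton, `P² = tr P • P - det P`, divided by `p`.
      refine ⟨e.symm (t • P *ᵥ e a - d • e a), e.injective ?_⟩
      rw [hPe, hPe, map_nsmul, e.apply_symm_apply]
      rw [trace_fin_two] at ht
      rw [det_fin_two] at hd
      generalize e a = v
      ext i
      fin_cases i
      · simp only [Fin.zero_eta, mulVec, dotProduct, Fin.sum_univ_two, Pi.sub_apply, Pi.smul_apply,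
          smul_eq_mul, nsmul_eq_mul]
        linear_combination (P 0 0 * v 0 + P 0 1 * v 1) * ht - v 0 * hd
      · simp only [Fin.mk_one, mulVec, dotProduct, Fin.sum_univ_two, Pi.sub_apply, Pi.smul_apply,
          smul_eq_mul, nsmul_eq_mul]
        linear_combination (P 1 0 * v 0 + P 1 1 * v 1) * ht - v 1 * hd
  · rintro ⟨hev, htr⟩
    refine AscendingHNN.isCyclicSubgroupSeparable_of_forall (fun n hn => ⟨?_, ?_⟩) ?_
    · have : NeZero n.natAbs := ⟨by simpa using hn⟩
      -- There are finitely many matrices modulo `n`, so two powers of `P` agree.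
      obtain ⟨k, l, hkl, heq⟩ := Finite.exists_ne_map_eq_of_infinite
        fun k : ℕ => ((Int.castRingHom (ZMod n.natAbs)).mapMatrix P) ^ k
      wlog hlt : k < l generalizing k l
      · exact this l k hkl.symm heq.symm (by omega)
      refine ⟨k, l - k, by omega, fun a => ?_⟩
      rw [Nat.add_sub_cancel' hlt.le]
      simp only [← map_pow] at heq
      have hdvd : ∀ i j, n ∣ (P ^ l - P ^ k) i j := by
        intro i j
        have h1 : (((P ^ k) i j : ℤ) : ZMod n.natAbs) = ((P ^ l) i j : ℤ) :=
          congrFun (congrFun heq i) j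
        rw [ZMod.intCast_eq_intCast_iff_dvd_sub] at h1
        exact Int.natAbs_dvd.1 h1
      choose Q hQ using hdvd
      refine ⟨e.symm ((Matrix.of Q) *ᵥ e a), e.injective ?_⟩
      rw [map_sub, hPs, hPs, map_zsmul, e.apply_symm_apply, ← sub_mulVec, ← smul_mulVec]
      congr 1
      ext i j
      exact hQ i j
    · refine ⟨e.symm '' Set.Icc 0 (fun _ => |n|), (Set.finite_Icc _ _).image _, fun a => ?_⟩
      refine ⟨_, ⟨fun i => e a i % n, ⟨fun i => Int.emod_nonneg _ hn,
        fun i => (Int.emod_lt_abs _ hn).le⟩, rfl⟩, e.symm fun i => e a i / n, e.injective ?_⟩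
      rw [map_sub, map_zsmul, e.apply_symm_apply, e.apply_symm_apply]
      ext i
      simp only [Pi.sub_apply, Pi.smul_apply, smul_eq_mul]
      linarith [Int.emod_add_mul_ediv (e a i) n]
    · intro a x h
      have hev' : ¬ ∃ (μ : ℤ) (v : Fin 2 → ℤ), 1 < |μ| ∧ v ≠ 0 ∧ P *ᵥ v = μ • v := by
        rintro ⟨μ, v, hμ, hv, hPv⟩
        refine hev ⟨μ, hμ, Module.End.hasEigenvalue_of_hasEigenvector (x := e.symm v) ⟨?_, ?_⟩⟩
        · rw [Module.End.mem_eigenspace_iff]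
          apply e.injective
          rw [map_zsmul, e.apply_symm_apply, ← hPv]
          simpa using hPe (e.symm v)
        · simpa using hv
      obtain ⟨i, hi⟩ := exists_eq_smul_of_eventuallyDvd hdet0 hev' htr (a := e a) (x := e x)
        fun n hn => by
          obtain ⟨i, s, c, hc⟩ := h n hn
          exact ⟨i, s, e c, by rw [← map_zsmul, ← map_sub, ← hPs, hc, map_zsmul]⟩
      exact ⟨i, e.injective (by rw [hi, map_zsmul])⟩
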